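/- An approach space is a set $X$ with a distance, i.e. a map $\delta : X\times 2^X\to[0,\infty]$ such that for all $x\in X$, $A,B\subseteq X$ and $\varepsilon\in[0,\infty]$: $\delta(x,\{x\})=0$; $\delta(x,\emptyset)=\infty$; $\delta(x,A\cup B)=\min\{\delta(x,A),\delta(x,B)\}$; and $\delta(x,A)\le\delta(x,\{y:\delta(y,A)\le\varepsilon\})+\varepsilon$. A subset $Y\subseteq X$ carries the restricted distance. A map $f:(X,\delta_X)\to(Z,\delta_Z)$ is a contraction if $\delta_Z(f(x),f(A))\le\delta_X(x,A)$ for all $x\in X$, $A\subseteq X$. For $\gamma\in[0,\infty)$ the interval $[0,\gamma]$ carries the distance $\delta(x,A)=\inf_{a\in A}|x-a|$. A development of a function $f:Y\to[0,\gamma]$ is a family $(\mu_\varepsilon)_{0<\varepsilon<1}$ of functions on $Y$, where each $\mu_\varepsilon$ takes the constant value $m_i^\varepsilon\in[0,\infty)$ on $M_i^\varepsilon$ for a finite partition $M_1^\varepsilon,\dots,M_{n(\varepsilon)}^\varepsilon$ of $Y$ (empty blocks allowed), such that $\mu_\varepsilon\le f\le\mu_\varepsilon+\varepsilon$ for all $\varepsilon\in(0,1)$.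 An approach space $(X,\delta)$ has Tietze's extension theorem for contractions if for every $Y\subseteq X$, every $\gamma\in[0,\infty)$ and every contraction $f:Y\to[0,\gamma]$ that has a development with $$m_l^\varepsilon-m_k^\varepsilon\le\delta(x,M_k^\varepsilon)+\delta(x,M_l^\varepsilon)\qquad\text{for all } x\in X\setminus Y,\ \varepsilon\in(0,1),\ 1\le l,k\le n(\varepsilon),$$ there is a contraction $g:X\to[0,\gamma]$ with $g|_Y=f$. Proposition. Let $(X,\mathcal T)$ be a topological space, and let $\delta_{\mathcal T}(x,A)=0$ if $x\in\operatorname{cl}A$ and $\delta_{\mathcal T}(x,A)=\infty$ otherwise. The following are equivalent: 1. $(X,\delta_{\mathcal T})$ has Tietze's extension theorem for contractions. 2. $(X,\mathcal T)$ satisfies the classical Tietze theorem: for every closed $Y\subseteq X$, every continuous $f:Y\to[0,1]$ has a continuous extension $g:X\to[0,1]$. 3. $(X,\mathcal T)$ satisfies the classical Tietze theorem for real-valued maps: for every closed $Y\subseteq X$, every continuous $f:Y\to\mathbb R$ has a continuous extension $g:X\to\mathbb R$. -/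

import Mathlib

open scoped ENNReal NNReal

noncomputable section

/-- A distance on `X` in the sense of approach theory: a function `δ : X × 2^X → [0, ∞]` with
properties (D1)-(D4). The set `X` together with such a distance is an approach space. -/
structure ApproachDistance (X : Type*) where
  /-- The distance `δ(x, A)` of a point to a set. -/
  δ : X → Set X → ℝ≥0∞
  singleton' : ∀ x, δ x {x} = 0
  empty' : ∀ x, δ x ∅ = ∞
  union' : ∀ x A B, δ x (A ∪ B) = min (δ x A) (δ x B)
  enlargement' : ∀ x A (ε : ℝ≥0∞), δ x A ≤ δ x {y | δ y A ≤ ε} + ε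

namespace ApproachDistance

/-- A distance is antitone in the set variable. -/
theorem anti {X : Type*} (D : ApproachDistance X) (x : X) {A B : Set X} (h : A ⊆ B) :
    D.δ x B ≤ D.δ x A := by
  have := D.union' x A B
  rw [Set.union_eq_self_of_subset_left h] at this
  rw [this]
  exact min_le_left _ _

/-- Contractions between approach spaces: `δ_Y(f(x), f(A)) ≤ δ_X(x, A)` for all `x` and `A`. -/
def IsContraction {X Y : Type*} (D : ApproachDistance X) (E : ApproachDistance Y)
    (f : X → Y) : Prop :=
  ∀ (x : X) (A : Set X), E.δ (f x) (f '' A) ≤ D.δ x A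

/-- The distance induced on a subset `Y ⊆ X`, that is, the restriction of `δ` to `Y × 2^Y`. -/
def subspace {X : Type*} (D : ApproachDistance X) (Y : Set X) : ApproachDistance Y where
  δ y A := D.δ y (Subtype.val '' A)
  singleton' y := by rw [Set.image_singleton]; exact D.singleton' _
  empty' y := by rw [Set.image_empty]; exact D.empty' _
  union' y A B := by rw [Set.image_union]; exact D.union' _ _ _
  enlargement' y A ε := by
    refine (D.enlargement' y (Subtype.val '' A) ε).trans ?_
    gcongr
    apply D.anti
    rintro _ ⟨z, hz, rfl⟩
    exact hz

/-- The distance `δ_q(x, A) = inf_{a ∈ A} q(x, a)` of an (extended, pseudo-) quasi-metric `q`. -/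
def ofQuasiMetric {X : Type*} (q : X → X → ℝ≥0∞) (q_self : ∀ x, q x x = 0)
    (q_triangle : ∀ x y z, q x z ≤ q x y + q y z) : ApproachDistance X where
  δ x A := ⨅ a ∈ A, q x a
  singleton' x := by simp [q_self]
  empty' x := by simp
  union' x A B := iInf_union
  enlargement' x A ε := by
    rw [ENNReal.iInf_add]
    refine le_iInf fun y => ?_
    by_cases hy : (⨅ a ∈ A, q y a) ≤ ε
    · have h : (⨅ a ∈ A, q x a) ≤ q x y + ε := by
        refine le_trans ?_ (add_le_add_right hy _)
        rw [ENNReal.add_iInf]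
        refine le_iInf fun a => ?_
        by_cases ha : a ∈ A
        · simpa [ha] using (iInf₂_le a ha).trans (q_triangle x y a)
        · simp [ha]
      simpa [hy] using h
    · simp [hy]

/-- The Euclidean metric `d_E` on `[0, ∞]`: the supremum of the quasi-metrics `x ⊖ y` and `y ⊖ x`,
where `⊖` is truncated subtraction (so that `∞ ⊖ ∞ = 0`). On finite values this is `|x - y|`. -/
def euclid (x y : ℝ≥0∞) : ℝ≥0∞ := max (x - y) (y - x)

/-- The approach space `([0, ∞], δ_{d_E})`. -/
def ennreal : ApproachDistance ℝ≥0∞ :=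
  ofQuasiMetric euclid (fun x => by simp [euclid]) (fun x y z => by
    refine max_le ?_ ?_
    · exact tsub_le_tsub_add_tsub.trans (add_le_add (le_max_left _ _) (le_max_left _ _))
    · refine (tsub_le_tsub_add_tsub (b := y)).trans ((add_comm _ _).trans_le ?_)
      exact add_le_add (le_max_right _ _) (le_max_right _ _))

/-- The approach space `([0, γ], δ_{d_E})`, as a subspace of `([0, ∞], δ_{d_E})`. -/
def segment (γ : ℝ≥0) : ApproachDistance (Set.Iic (γ : ℝ≥0∞)) :=
  ennreal.subspace (Set.Iic (γ : ℝ≥0∞))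

open Classical in
/-- The distance `δ_T` of a topological space: `0` on the closure of `A`, and `∞` off it. -/
def ofTopology (X : Type*) [TopologicalSpace X] : ApproachDistance X where
  δ x A := if x ∈ closure A then 0 else ∞
  singleton' x := if_pos (subset_closure (Set.mem_singleton x))
  empty' x := by simp
  union' x A B := by
    rw [closure_union]
    by_cases hA : x ∈ closure A <;> by_cases hB : x ∈ closure B <;> simp [hA, hB]
  enlargement' x A ε := by
    by_cases hε : ε = ∞
    · simp [hε]
    · have h : {y : X | (if y ∈ closure A then (0 : ℝ≥0∞) else ∞) ≤ ε} = closure A := by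
        ext y
        by_cases hy : y ∈ closure A <;> simp [hy, hε]
      rw [h, closure_closure]
      exact le_self_add

end ApproachDistance

open Classical in
/-- The function `θ_A`: `0` on `A`, and `∞` off `A`. -/
def approachTheta {X : Type*} (A : Set X) (x : X) : ℝ≥0∞ := if x ∈ A then 0 else ∞

/-- The data `(m_i, M_i)_{i = 1, …, n}` that define a function with finitely many values: a finite
partition `(M_i)` of `X` (empty blocks are allowed) and numbers `m_i ∈ [0, ∞)`. -/
structure FiniteStep (X : Type*) where
  /-- The number of blocks. -/
  n : ℕ
  /-- The value on each block. -/
  m : Fin n → ℝ≥0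
  /-- The blocks. -/
  M : Fin n → Set X
  disjoint : ∀ i j, i ≠ j → Disjoint (M i) (M j)
  cover : ⋃ i, M i = Set.univ

/-- The function `⋀_i (m_i + θ_{M_i})`. -/
def FiniteStep.toFun {X : Type*} (s : FiniteStep X) (x : X) : ℝ≥0∞ :=
  ⨅ i, ((s.m i : ℝ≥0∞) + approachTheta (s.M i) x)

/-- The family `(μ_ε)_{0 < ε < 1}` is a development of `f`: `μ_ε ≤ f ≤ μ_ε + ε` for all `ε` in
`(0, 1)`. The members of the family at other indices play no role. -/
def IsDevelopment {X : Type*} (f : X → ℝ≥0∞) (μ : ℝ≥0 → FiniteStep X) : Prop :=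
  ∀ ε : ℝ≥0, 0 < ε → ε < 1 → ∀ x, (μ ε).toFun x ≤ f x ∧ f x ≤ (μ ε).toFun x + ε

/-- Tietze's extension theorem for contractions on an approach space `(X, δ)`: for all `Y ⊆ X` and
`γ ∈ [0, ∞)`, each contraction `f : Y → [0, γ]` that has a development `(μ_ε)_{0 < ε < 1}` with
`m_l^ε - m_k^ε ≤ δ(x, M_k^ε) + δ(x, M_l^ε)` for all `x ∉ Y`, `ε`, `l`, `k` extends to a contraction
`X → [0, γ]`. (The right-hand side is nonnegative, so truncated subtraction is harmless.) -/
def ApproachTietze {X : Type*} (D : ApproachDistance X) : Prop :=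
  ∀ (Y : Set X) (γ : ℝ≥0) (f : Y → Set.Iic (γ : ℝ≥0∞)),
    (D.subspace Y).IsContraction (ApproachDistance.segment γ) f →
    (∃ μ : ℝ≥0 → FiniteStep Y, IsDevelopment (fun y => (f y : ℝ≥0∞)) μ ∧
      ∀ x, x ∉ Y → ∀ ε : ℝ≥0, 0 < ε → ε < 1 → ∀ l k : Fin (μ ε).n,
        ((μ ε).m l : ℝ≥0∞) - (μ ε).m k ≤
          D.δ x (Subtype.val '' (μ ε).M k) + D.δ x (Subtype.val '' (μ ε).M l)) →
    ∃ g : X → Set.Iic (γ : ℝ≥0∞),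
      D.IsContraction (ApproachDistance.segment γ) g ∧ ∀ y : Y, g y = f y

/-- The classical Tietze extension property of a topological space `X` with values in `Z`: each
continuous map from a closed subspace of `X` to `Z` has a continuous extension to `X`. -/
def ClassicalTietze (X : Type*) [TopologicalSpace X] (Z : Type*) [TopologicalSpace Z] : Prop :=
  ∀ Y : Set X, IsClosed Y → ∀ f : Y → Z, Continuous f →
    ∃ g : X → Z, Continuous g ∧ ∀ y : Y, g y = f y

end

open Set Filter Topology

/-! All three properties are equivalent to normality. Extending a two-valued function from a
disjoint union of closed sets gives normality, and the usual Tietze theorem gives the converse.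
Contractions into a segment are the continuous functions. For closed `Y` the development condition
is vacuous, since distances from outside `Y` to blocks are infinite. For arbitrary `Y`, at a point
of `closure Y` off `Y` it makes all blocks clustering there share one value, so `f` oscillates by at
most `ε` and has a limit (`exists_tendsto_of_development`). Thus `f` extends to `closure Y` and
then, by normality, to `X`. -/

/-- A space with the extension property for maps into some nontrivial space is normal. -/
theorem ClassicalTietze.normalSpace {X Z : Type*} [TopologicalSpace X] [TopologicalSpace Z]
    (h : ClassicalTietze X Z) [T2Space Z] [Nontrivial Z] : NormalSpace X := by
  classical
  obtain ⟨a, b, hab⟩ := exists_pair_ne Z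
  refine ⟨fun A B hA hB hAB => ?_⟩
  -- Clopenness of `A` in `A ∪ B` makes the function equal to `a` on `A` and `b` on `B` continuous.
  have hclopen : IsClopen {y : (A ∪ B : Set X) | (y : X) ∈ A} := by
    refine ⟨hA.preimage continuous_subtype_val, ?_⟩
    have : {y : (A ∪ B : Set X) | (y : X) ∈ A} = (Subtype.val ⁻¹' B)ᶜ := by
      ext y
      exact ⟨fun hy hy' => hAB.le_bot ⟨hy, hy'⟩, fun hy => y.2.resolve_right hy⟩
    rw [this]
    exact (hB.preimage continuous_subtype_val).isOpen_compl
  obtain ⟨g, hg, hgf⟩ := h (A ∪ B) (hA.union hB) (fun y => if (y : X) ∈ A then a else b)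
    (Continuous.if (by simp [hclopen.frontier_eq]) continuous_const continuous_const)
  obtain ⟨U, V, hU, hV, haU, hbV, hUV⟩ := t2_separation hab
  refine ⟨g ⁻¹' U, g ⁻¹' V, hU.preimage hg, hV.preimage hg, fun x hx => ?_, fun x hx => ?_,
    hUV.preimage g⟩
  · have := hgf ⟨x, Or.inl hx⟩
    simp only [hx, if_true] at this
    simpa [this] using haU
  · have := hgf ⟨x, Or.inr hx⟩
    simp only [disjoint_right.1 hAB hx, if_false] at this
    simpa [this] using hbV

universe u

theorem classicalTietze_of_normalSpace {X : Type u} [TopologicalSpace X] [NormalSpace X]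
    {Z : Type} [TopologicalSpace Z] [TietzeExtension.{u} Z] : ClassicalTietze X Z := by
  intro Y hY f hf
  obtain ⟨g, hg⟩ := ContinuousMap.exists_restrict_eq hY ⟨f, hf⟩
  exact ⟨g, g.continuous, fun y => congrArg (fun φ : C(Y, Z) => φ y) hg⟩

theorem euclid_eq_edist_toReal {a b : ℝ≥0∞} (ha : a ≠ ∞) (hb : b ≠ ∞) :
    ApproachDistance.euclid a b = edist a.toReal b.toReal := by
  lift a to ℝ≥0 using ha
  lift b to ℝ≥0 using hb
  simp only [ApproachDistance.euclid, ENNReal.coe_toReal, edist_dist, Real.dist_eq]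
  rcases le_total a b with h | h
  · rw [abs_of_nonpos (by simpa using h), neg_sub, ← NNReal.coe_sub h, ENNReal.ofReal_coe_nnreal,
      ENNReal.coe_sub, max_eq_right]
    simp [tsub_eq_zero_of_le (ENNReal.coe_le_coe.2 h)]
  · rw [abs_of_nonneg (by simpa using h), ← NNReal.coe_sub h, ENNReal.ofReal_coe_nnreal,
      ENNReal.coe_sub, max_eq_left]
    simp [tsub_eq_zero_of_le (ENNReal.coe_le_coe.2 h)]

theorem ne_top_of_mem_Iic {γ : ℝ≥0} (a : Iic (γ : ℝ≥0∞)) : (a : ℝ≥0∞) ≠ ∞ :=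
  ne_top_of_le_ne_top ENNReal.coe_ne_top a.2

/-- Passing to real numbers makes the metric description of closure available. -/
theorem segment_δ {γ : ℝ≥0} (p : Iic (γ : ℝ≥0∞)) (A : Set (Iic (γ : ℝ≥0∞))) :
    (ApproachDistance.segment γ).δ p A =
      Metric.infEDist (p : ℝ≥0∞).toReal ((fun a : Iic (γ : ℝ≥0∞) => (a : ℝ≥0∞).toReal) '' A) := by
  simp only [ApproachDistance.segment, ApproachDistance.subspace, ApproachDistance.ennreal,
    ApproachDistance.ofQuasiMetric, Metric.infEDist, iInf_image]
  refine iInf_congr fun a => iInf_congr fun _ => ?_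
  exact euclid_eq_edist_toReal (ne_top_of_mem_Iic p) (ne_top_of_mem_Iic a)

/-- Contractions from a topological approach space to a segment are the continuous functions. -/
theorem isContraction_ofTopology_segment_iff {X : Type*} [TopologicalSpace X] {γ : ℝ≥0}
    {f : X → Iic (γ : ℝ≥0∞)} :
    (ApproachDistance.ofTopology X).IsContraction (ApproachDistance.segment γ) f ↔
      Continuous fun x => (f x : ℝ≥0∞).toReal := by
  simp only [ApproachDistance.IsContraction, segment_δ, ApproachDistance.ofTopology,
    continuous_iff_image_closure_subset_closure_image, image_subset_iff, image_image]
  -- As `δ_T` is `0` or `∞`, the contraction inequality has content only on `closure A`, where it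
  -- says that the image point has distance zero from the image of `A`.
  refine ⟨fun h A x hx => ?_, fun h x A => ?_⟩
  · have := h x A
    rw [if_pos hx, nonpos_iff_eq_zero] at this
    exact Metric.mem_closure_iff_infEDist_zero.2 this
  · split_ifs with hx
    · exact (Metric.mem_closure_iff_infEDist_zero.1 (h A hx)).le
    · exact le_top

theorem ofTopology_subspace {X : Type*} [TopologicalSpace X] (Y : Set X) :
    (ApproachDistance.ofTopology X).subspace Y = ApproachDistance.ofTopology Y := by
  simp only [ApproachDistance.subspace, ApproachDistance.ofTopology, ApproachDistance.mk.injEq]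
  classical
  funext y A
  exact if_congr closure_subtype.symm rfl rfl

theorem FiniteStep.toFun_eq {X : Type*} (s : FiniteStep X) {x : X} {i : Fin s.n}
    (hx : x ∈ s.M i) : s.toFun x = s.m i := by
  refine le_antisymm ((iInf_le _ i).trans (by simp [approachTheta, hx])) (le_iInf fun j => ?_)
  by_cases hij : i = j
  · simp [hij]
  · have : x ∉ s.M j := fun h => (s.disjoint i j hij).le_bot ⟨hx, h⟩
    simp [approachTheta, this]

theorem FiniteStep.exists_mem {X : Type*} (s : FiniteStep X) (x : X) : ∃ i, x ∈ s.M i := by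
  simpa using s.cover.ge (mem_univ x)

/-- Rounding a function with values in `[0, 1]` down to a multiple of `ε`. -/
noncomputable def FiniteStep.ofFloor {X : Type*} (f : X → ℝ≥0) (hf : ∀ x, f x ≤ 1) (ε : ℝ≥0) :
    FiniteStep X where
  -- Both endpoints occur among the possible floors `0, …, ⌊1 / ε⌋`.
  n := ⌊1 / ε⌋₊ + 1
  m i := i * ε
  M i := {x | ⌊f x / ε⌋₊ = i}
  disjoint i j hij := Set.disjoint_left.2 fun x hi hj => hij (Fin.ext (hi.symm.trans hj))
  cover := eq_univ_of_forall fun x => mem_iUnion.2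
    ⟨⟨⌊f x / ε⌋₊, Nat.lt_succ_of_le (Nat.floor_mono (by gcongr; exact hf x))⟩, rfl⟩

theorem isDevelopment_ofFloor {X : Type*} (f : X → ℝ≥0) (hf : ∀ x, f x ≤ 1) :
    IsDevelopment (fun x => (f x : ℝ≥0∞)) (FiniteStep.ofFloor f hf) := by
  intro ε hε _ x
  obtain ⟨i, hi⟩ := (FiniteStep.ofFloor f hf ε).exists_mem x
  rw [FiniteStep.toFun_eq _ hi]
  have hi' : ⌊f x / ε⌋₊ = i := hi
  change (((i : ℕ) * ε : ℝ≥0) : ℝ≥0∞) ≤ f x ∧ (f x : ℝ≥0∞) ≤ (((i : ℕ) * ε : ℝ≥0) : ℝ≥0∞) + ε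
  rw [← hi']
  norm_cast
  constructor
  · exact (le_div_iff₀ hε).1 (Nat.floor_le zero_le)
  · have := (div_lt_iff₀ hε).1 (Nat.lt_floor_add_one (f x / ε))
    rw [add_mul, one_mul] at this
    exact this.le

theorem ApproachTietze.classicalTietze {X : Type*} [TopologicalSpace X]
    (h : ApproachTietze (ApproachDistance.ofTopology X)) :
    ClassicalTietze X (Icc (0 : ℝ) 1) := by
  intro Y hY f hf
  let F : Y → ℝ≥0 := fun y => ⟨f y, (f y).2.1⟩
  have hF : ∀ y, F y ≤ 1 := fun y => (f y).2.2
  obtain ⟨g, hg, hgf⟩ := h Y 1 (fun y => ⟨F y, ENNReal.coe_le_coe.2 (hF y)⟩)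
    (by
      rw [ofTopology_subspace, isContraction_ofTopology_segment_iff]
      exact (continuous_subtype_val.comp hf :))
    ⟨_, isDevelopment_ofFloor F hF, fun x hx ε _ _ l k => by
      -- Blocks lie in the closed set `Y`, so the right-hand side is `∞`.
      have : x ∉ closure (Subtype.val '' (FiniteStep.ofFloor F hF ε).M k) := fun hx' =>
        hx (closure_minimal (Subtype.coe_image_subset _ _) hY hx')
      simp [ApproachDistance.ofTopology, this]⟩
  rw [isContraction_ofTopology_segment_iff] at hg
  refine ⟨fun x => ⟨(g x : ℝ≥0∞).toReal, ENNReal.toReal_nonneg, ?_⟩, hg.subtype_mk _, fun y => ?_⟩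
  · simpa using ENNReal.toReal_mono ENNReal.coe_ne_top (g x).2
  · ext
    simp only [hgf]
    exact ENNReal.coe_toReal _

/-- If near each point off `Y` the values of `f` on the blocks that cluster there agree up to `ε`,
then `f` has a limit at that point. -/
theorem exists_tendsto_of_development {X : Type*} [TopologicalSpace X] {Y : Set X}
    {f : Y → ℝ≥0∞} (hf : ∀ y, f y ≠ ∞) {μ : ℝ≥0 → FiniteStep Y} (hμ : IsDevelopment f μ) {x : X}
    (hx : x ∈ closure Y)
    (h : ∀ ε : ℝ≥0, 0 < ε → ε < 1 → ∀ l k : Fin (μ ε).n,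
        ((μ ε).m l : ℝ≥0∞) - (μ ε).m k ≤
          (ApproachDistance.ofTopology X).δ x (Subtype.val '' (μ ε).M k) +
            (ApproachDistance.ofTopology X).δ x (Subtype.val '' (μ ε).M l)) :
    ∃ z, Tendsto (fun y => (f y).toReal) (comap Subtype.val (𝓝 x)) (𝓝 z) := by
  have hne : NeBot (comap (Subtype.val : Y → X) (𝓝 x)) := mem_closure_iff_comap_neBot.1 hx
  refine cauchy_map_iff_exists_tendsto.1 (Metric.cauchy_iff.2 ⟨inferInstance, fun r hr => ?_⟩)
  obtain ⟨ε, hε0, hε⟩ := exists_between (show (0 : ℝ≥0) < min 1 ⟨r, hr.le⟩ from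
    lt_min one_pos hr)
  have hε1 : ε < 1 := hε.trans_le (min_le_left _ _)
  have hεr : (ε : ℝ) < r := NNReal.coe_lt_coe.2 (hε.trans_le (min_le_right _ _))
  -- There are finitely many blocks, so one neighbourhood of `x` avoids all those not clustering at
  -- `x`.
  have hU : {y : Y | ∀ k, y ∈ (μ ε).M k → x ∈ closure (Subtype.val '' (μ ε).M k)} ∈
      comap (Subtype.val : Y → X) (𝓝 x) := by
    change ∀ᶠ y in comap (Subtype.val : Y → X) (𝓝 x), _
    rw [eventually_all]
    intro k
    by_cases hk : x ∈ closure (Subtype.val '' (μ ε).M k)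
    · simp [hk]
    · refine mem_comap.2 ⟨_, isClosed_closure.isOpen_compl.mem_nhds hk, fun y hy hyk => ?_⟩
      exact absurd (subset_closure (mem_image_of_mem _ hyk)) hy
  -- Both distances vanish, hence `f y ≤ m l + ε ≤ m k + ε ≤ f z + ε`.
  have key : ∀ y z : Y, (∀ k, y ∈ (μ ε).M k → x ∈ closure (Subtype.val '' (μ ε).M k)) →
      (∀ k, z ∈ (μ ε).M k → x ∈ closure (Subtype.val '' (μ ε).M k)) →
      (f y).toReal ≤ (f z).toReal + ε := by
    intro y z hy hz
    obtain ⟨l, hl⟩ := (μ ε).exists_mem y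
    obtain ⟨k, hk⟩ := (μ ε).exists_mem z
    have hlk := h ε hε0 hε1 l k
    simp only [ApproachDistance.ofTopology, if_pos (hy l hl), if_pos (hz k hk), add_zero,
      nonpos_iff_eq_zero, tsub_eq_zero_iff_le] at hlk
    have h1 := (hμ ε hε0 hε1 y).2
    have h2 := (hμ ε hε0 hε1 z).1
    rw [(μ ε).toFun_eq hl] at h1
    rw [(μ ε).toFun_eq hk] at h2
    have := ENNReal.toReal_mono (ENNReal.add_ne_top.2 ⟨hf z, ENNReal.coe_ne_top⟩)
      (h1.trans (add_le_add_left (hlk.trans h2) (ε : ℝ≥0∞)))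
    rwa [ENNReal.toReal_add (hf z) ENNReal.coe_ne_top, ENNReal.coe_toReal] at this
  refine ⟨_, image_mem_map hU, ?_⟩
  rintro _ ⟨y, hy, rfl⟩ _ ⟨z, hz, rfl⟩
  rw [Real.dist_eq, abs_lt]
  have h1 := key y z hy hz
  have h2 := key z y hz hy
  constructor <;> linarith

/-- A continuous real function with limits at all points of the closure of its domain extends
continuously to a normal space. -/
theorem exists_continuous_extension_of_tendsto {X : Type*} [TopologicalSpace X] [NormalSpace X]
    {Y : Set X} {f : Y → ℝ} (hf : Continuous f)
    (h : ∀ x ∈ closure Y, x ∉ Y → ∃ z, Tendsto f (comap Subtype.val (𝓝 x)) (𝓝 z)) :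
    ∃ g : X → ℝ, Continuous g ∧ ∀ y : Y, g y = f y := by
  -- The value `0` off `Y` is immaterial: limits are taken within `Y`.
  let F : X → ℝ := Function.extend Subtype.val f 0
  have hF : ∀ y : Y, F y = f y := fun y => Subtype.val_injective.extend_apply f 0 y
  have hlim : ∀ x z, Tendsto f (comap Subtype.val (𝓝 x)) (𝓝 z) → Tendsto F (𝓝[Y] x) (𝓝 z) := by
    intro x z hz
    rw [nhdsWithin, ← subtype_coe_map_comap, tendsto_map'_iff]
    exact hz.congr fun y => (hF y).symm
  have hY : ∀ y : Y, Tendsto F (𝓝[Y] y) (𝓝 (f y)) := fun y =>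
    hlim _ _ (by rw [← nhds_subtype]; exact hf.tendsto y)
  -- Extension by limits is continuous because `ℝ` is regular.
  have hc : ContinuousOn (extendFrom Y F) (closure Y) := by
    refine continuousOn_extendFrom Subset.rfl fun x hx => ?_
    by_cases hxY : x ∈ Y
    · exact ⟨_, hY ⟨x, hxY⟩⟩
    · obtain ⟨z, hz⟩ := h x hx hxY
      exact ⟨z, hlim x z hz⟩
  obtain ⟨g, hg, hgF⟩ := classicalTietze_of_normalSpace (Z := ℝ) (closure Y) isClosed_closure _
    (continuousOn_iff_continuous_domRestrict.1 hc)
  exact ⟨g, hg, fun y => (hgF ⟨y, subset_closure y.2⟩).trans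
    (extendFrom_eq (subset_closure y.2) (hY y))⟩

theorem approachTietze_ofTopology_of_normalSpace {X : Type*} [TopologicalSpace X]
    [NormalSpace X] : ApproachTietze (ApproachDistance.ofTopology X) := by
  rintro Y γ f hf ⟨μ, hμ, hδ⟩
  rw [ofTopology_subspace, isContraction_ofTopology_segment_iff] at hf
  obtain ⟨g, hg, hgf⟩ := exists_continuous_extension_of_tendsto hf fun x hx hxY =>
    exists_tendsto_of_development (fun y => ne_top_of_mem_Iic (f y)) hμ hx (hδ x hxY)
  -- The extension may leave `[0, γ]`: `min` cuts it at `γ` and `ENNReal.ofReal` at `0`, neither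
  -- affecting values on `Y`.
  refine ⟨fun x => ⟨ENNReal.ofReal (min (g x) γ), ?_⟩, ?_, fun y => ?_⟩
  · exact (ENNReal.ofReal_le_ofReal (min_le_right _ _)).trans_eq (ENNReal.ofReal_coe_nnreal)
  · rw [isContraction_ofTopology_segment_iff]
    simp only [ENNReal.toReal_ofReal']
    fun_prop
  · have hle : (f y : ℝ≥0∞).toReal ≤ γ := by
      simpa using ENNReal.toReal_mono ENNReal.coe_ne_top (f y).2
    ext
    simp only [hgf, min_eq_left hle, ENNReal.ofReal_toReal (ne_top_of_mem_Iic (f y))]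

theorem mainTheorem8 (X : Type*) [TopologicalSpace X] :
    List.TFAE [
      ApproachTietze (ApproachDistance.ofTopology X),
      ClassicalTietze X (Set.Icc (0 : ℝ) 1),
      ClassicalTietze X ℝ] := by
  tfae_have 1 → 2 := fun h => h.classicalTietze
  tfae_have 2 → 3 := fun h =>
    have := h.normalSpace
    classicalTietze_of_normalSpace
  tfae_have 3 → 1 := fun h =>
    have := h.normalSpace
    approachTietze_ofTopology_of_normalSpace
  tfae_finish
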